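/- Let $D$ be a compact connected Riemann surface with a Riemannian metric compatible with its complex structure, with area measure $dA$, and let $K_D$ be its canonical bundle. Let $N\to D$ be a holomorphic line bundle with a smooth Hermitian metric $\langle\cdot,\cdot\rangle$, let $(\cdot,\cdot)=\operatorname{Re}\langle\cdot,\cdot\rangle$ on $N$ and on $\overline{K}_D\otimes N$ (with the induced metric), let $J$ denote multiplication by $i$ on either bundle, and let $\Omega^0(N)$ and $\Omega^{0,1}(N)$ be the spaces of smooth sections of $N$ and of $\overline{K}_D\otimes N$. Let $\bar\partial:\Omega^0(N)\to\Omega^{0,1}(N)$ be the Cauchy--Riemann operator of $N$ and let $\bar\partial^*$ be its formal $L^2$-adjoint, i.e. $\int_D(\bar\partial\zeta,\alpha)\,dA=\int_D(\zeta,\bar\partial^*\alpha)\,dA$ for all $\zeta\in\Omega^0(N)$ and $\alpha\in\Omega^{0,1}(N)$. Let $\varphi$ be a holomorphic section of $K_D\otimes(N^*)^2$ that is not identically zero, and let $R:N\to\overline{K}_D\otimes N$ be a smooth real-linear bundle map which, together with its pointwise adjoint $R^*$ with respect to $(\cdot,\cdot)$, satisfies $$\text{(a)}\ \ RJ=-JR,\qquad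 \text{(b)}\ \ R^*R=|\varphi|^2\,\mathrm{Id},\qquad \text{(c)}\ \ \bar\partial^*R+R^*\bar\partial=0 .$$ Then for every real $t\neq0$ the operator $L_t=\bar\partial+tR:\Omega^0(N)\to\Omega^{0,1}(N)$ has $\ker L_t=0$. -/

import Mathlib

open Bundle MeasureTheory
open scoped Manifold ContDiff ComplexConjugate

noncomputable section


namespace AntilinearDbar

/-! ### Real-smooth sections, Hermitian metrics, frames -/

section Basic

variable {D : Type*} [TopologicalSpace D] [ChartedSpace ℂ D]
  {E : D → Type*} [∀ x, AddCommGroup (E x)] [∀ x, Module ℂ (E x)]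
  [TopologicalSpace (TotalSpace ℂ E)] [∀ x, TopologicalSpace (E x)] [FiberBundle ℂ E]

/-- `Ω⁰(E)`: the section `ξ` is smooth in the real sense. -/
def IsSmoothSection (ξ : ∀ x, E x) : Prop :=
  ContMDiff 𝓘(ℝ, ℂ) (𝓘(ℝ, ℂ).prod 𝓘(ℝ, ℂ)) ∞ (fun x => TotalSpace.mk' ℂ x (ξ x))

variable (E) in
/-- A smooth Hermitian metric `⟨u, v⟩` on the complex line bundle `E`, linear in the first and
conjugate-linear in the second variable. Smoothness is smoothness of `u ↦ ⟨u, u⟩` on the total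
space. For `E` the holomorphic tangent bundle of a Riemann surface, this is the same as a
Riemannian metric `Re ⟨u, v⟩` compatible with the complex structure. -/
structure HermitianMetric where
  inner : ∀ x, E x →ₗ[ℂ] E x →ₗ⋆[ℂ] ℂ
  conj_symm : ∀ x u v, conj (inner x u v) = inner x v u
  pos : ∀ x u, u ≠ 0 → 0 < (inner x u u).re
  smooth : ContMDiff (𝓘(ℝ, ℂ).prod 𝓘(ℝ, ℂ)) 𝓘(ℝ, ℝ) ∞
    (fun u : TotalSpace ℂ E => (inner u.1 u.2 u.2).re)

/-- `|u|²`. -/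
def HermitianMetric.normSq (h : HermitianMetric E) (x : D) (u : E x) : ℝ := (h.inner x u u).re

/-- The positive definite real inner product `(u, v) = Re ⟨u, v⟩`. -/
def HermitianMetric.re (h : HermitianMetric E) (x : D) (u v : E x) : ℝ := (h.inner x u v).re

variable [VectorBundle ℂ ℂ E]

variable (E) in
/-- The local frame of the line bundle `E` given by the preferred trivialization at `x`, at the
point `y`. -/
def localFrame (x y : D) : E y := (trivializationAt ℂ E x).symmL ℂ y 1

variable (E) in
/-- A nonzero vector in the fibre of the line bundle `E` over `x`. -/
def frame (x : D) : E x := localFrame E x x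

lemma frame_ne_zero (x : D) : frame E x ≠ 0 := by
  intro h0
  have hx := FiberBundle.mem_baseSet_trivializationAt' (F := ℂ) (E := E) x
  have h1 := (trivializationAt ℂ E x).continuousLinearMapAt_symmL (R := ℂ) hx 1
  have h2 : (trivializationAt ℂ E x).symmL ℂ x 1 = 0 := h0
  rw [h2, map_zero] at h1
  exact zero_ne_one h1

/-- The fibres of `E` are complex lines, spanned by any nonzero vector. -/
lemma exists_eq_smul (x : D) {v : E x} (hv : v ≠ 0) (w : E x) : ∃ c : ℂ, w = c • v := by
  have hx := FiberBundle.mem_baseSet_trivializationAt' (F := ℂ) (E := E) x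
  let L := (trivializationAt ℂ E x).continuousLinearEquivAt ℂ x hx
  have h0 : L v ≠ 0 := by simpa using hv
  refine ⟨L w / L v, L.injective ?_⟩
  rw [map_smul, smul_eq_mul, div_mul_cancel₀ _ h0]

lemma HermitianMetric.inner_self (h : HermitianMetric E) (x : D) (u : E x) :
    h.inner x u u = (h.normSq x u : ℂ) := by
  have := Complex.conj_eq_iff_real.1 (h.conj_symm x u u)
  obtain ⟨r, hr⟩ := this
  simp [HermitianMetric.normSq, hr]

lemma HermitianMetric.normSq_smul (h : HermitianMetric E) (x : D) (c : ℂ) (u : E x) :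
    h.normSq x (c • u) = ‖c‖ ^ 2 * h.normSq x u := by
  have : ((h.normSq x (c • u) : ℝ) : ℂ) = ((‖c‖ ^ 2 * h.normSq x u : ℝ) : ℂ) := by
    rw [← h.inner_self]
    simp only [map_smul, map_smulₛₗ, LinearMap.smul_apply, smul_eq_mul, h.inner_self]
    push_cast
    rw [← Complex.mul_conj']
    ring
  exact_mod_cast this

end Basic

/-! ### `(0,1)`-forms with values in a holomorphic line bundle and the operator `∂̄` -/

section Forms

variable {D : Type*} [TopologicalSpace D] [ChartedSpace ℂ D] [IsManifold 𝓘(ℂ) ω D]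
  {E : D → Type*} [∀ x, AddCommGroup (E x)] [∀ x, Module ℂ (E x)]
  [TopologicalSpace (TotalSpace ℂ E)] [∀ x, TopologicalSpace (E x)] [FiberBundle ℂ E]
  [VectorBundle ℂ ℂ E] [∀ x, IsTopologicalAddGroup (E x)] [∀ x, ContinuousSMul ℂ (E x)]

variable (E) in
/-- The fibre at `x` of `K̄_D ⊗ E = Λ^{0,1} T^*D ⊗ E`: conjugate-linear maps `T_x D → E_x`. -/
abbrev Form01 (x : D) : Type _ := TangentSpace 𝓘(ℂ) x →SL[starRingEnd ℂ] E x

variable (E) in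
/-- The fibre at `x` of `K_D ⊗ (E^*)²`: complex multilinear maps `T_x D × E_x × E_x → ℂ`. -/
abbrev CanonicalTwist (x : D) : Type _ :=
  TangentSpace 𝓘(ℂ) x →ₗ[ℂ] E x →ₗ[ℂ] E x →ₗ[ℂ] ℂ

variable (E) in
/-- `φ` is a holomorphic section of `K_D ⊗ (E^*)²`: in the local holomorphic coordinate `z` and the
local holomorphic frame `ν` of `E` around each point `p`, its coefficient `φ(∂_z, ν, ν)` is a
holomorphic function. -/
def IsHolomorphicTwist (φ : ∀ x : D, CanonicalTwist E x) : Prop :=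
  ∀ p : D, MDifferentiableOn 𝓘(ℂ) 𝓘(ℂ)
    (fun y => φ y (localFrame (fun x : D => TangentSpace 𝓘(ℂ) x) p y)
      (localFrame E p y) (localFrame E p y))
    ((chartAt ℂ p).source ∩ (trivializationAt ℂ E p).baseSet)

/-- The conjugate-linear part `v ↦ (L v + i L (i v)) / 2` of a real-linear map `L : ℂ → ℂ`. -/
def antilinearPart (L : ℂ →L[ℝ] ℂ) : ℂ →SL[starRingEnd ℂ] ℂ where
  toFun v := (L v + Complex.I * L (Complex.I * v)) / 2
  map_add' v w := by simp only [mul_add, map_add]; ring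
  map_smul' c v := by
    have key : ∀ z : ℂ, L z = z.re * L 1 + z.im * L Complex.I := fun z => by
      conv_lhs => rw [← Complex.re_add_im z]
      rw [map_add, show (z.re : ℂ) = z.re • (1 : ℂ) by simp,
        show (z.im : ℂ) * Complex.I = z.im • Complex.I by simp, map_smul, map_smul]
      simp
    rw [key (c • v), key (Complex.I * c • v), key v, key (Complex.I * v)]
    apply Complex.ext <;> simp <;> ring
  cont := by fun_prop

/-- The `∂̄`-operator of the holomorphic line bundle `E`. At `x`, write `ξ = f ν` with `ν` the
holomorphic frame of the preferred trivialization at `x`; then `∂̄ξ = (∂̄f) ν`, where `∂̄f` is the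
conjugate-linear part of the real differential of `f`. -/
def dbar (ξ : ∀ x, E x) (x : D) : Form01 E x :=
  ((trivializationAt ℂ E x).symmL ℂ x).comp
    (antilinearPart (mfderiv 𝓘(ℝ, ℂ) 𝓘(ℝ, ℂ)
      (fun y => (trivializationAt ℂ E x (TotalSpace.mk' ℂ y (ξ y))).2) x))

/-- The Hermitian inner product on the fibre of `K̄_D ⊗ E` at `x` induced by the metrics `g` on `D`
and `h` on `E`: it is `⟨A v, B v⟩ / |v|²` for any `v ≠ 0` in `T_x D`. -/
def formInner (g : HermitianMetric (fun x : D => TangentSpace 𝓘(ℂ) x)) (h : HermitianMetric E)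
    (x : D) (A B : Form01 E x) : ℂ :=
  let v := frame (fun x : D => TangentSpace 𝓘(ℂ) x) x
  h.inner x (A v) (B v) / g.normSq x v

lemma formInner_eq (g : HermitianMetric (fun x : D => TangentSpace 𝓘(ℂ) x))
    (h : HermitianMetric E) (x : D) (A B : Form01 E x) (v : TangentSpace 𝓘(ℂ) x) (hv : v ≠ 0) :
    formInner g h x A B = h.inner x (A v) (B v) / g.normSq x v := by
  obtain ⟨c, hc⟩ := exists_eq_smul (E := fun x : D => TangentSpace 𝓘(ℂ) x) x
    (frame_ne_zero (E := fun x : D => TangentSpace 𝓘(ℂ) x) x) v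
  have hc0 : c ≠ 0 := by rintro rfl; exact hv (by rw [hc, zero_smul])
  have hg : g.normSq x (frame (fun x : D => TangentSpace 𝓘(ℂ) x) x) ≠ 0 :=
    (g.pos x _ (frame_ne_zero (E := fun x : D => TangentSpace 𝓘(ℂ) x) x)).ne'
  have hn : ((‖c‖ : ℝ) : ℂ) ≠ 0 := by simpa using hc0
  rw [hc, g.normSq_smul]
  simp only [formInner, map_smulₛₗ, LinearMap.smul_apply, smul_eq_mul, RingHomCompTriple.comp_apply]
  push_cast
  rw [← Complex.mul_conj']
  have hcc : conj c ≠ 0 := by simpa using hc0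
  have hg' : (g.normSq x (frame (fun x : D => TangentSpace 𝓘(ℂ) x) x) : ℂ) ≠ 0 := by
    exact_mod_cast hg
  field_simp
  rfl

/-- The real inner product `(A, B) = Re ⟨A, B⟩` on the fibre of `K̄_D ⊗ E` at `x`. -/
def formRe (g : HermitianMetric (fun x : D => TangentSpace 𝓘(ℂ) x)) (h : HermitianMetric E)
    (x : D) (A B : Form01 E x) : ℝ := (formInner g h x A B).re

/-- The pointwise norm squared `|φ|²` of a section of `K_D ⊗ (E^*)²`: it is
`|φ(v, ν, ν)|² / (|v|² |ν|⁴)` for any `v ≠ 0` in `T_x D` and `ν ≠ 0` in `E_x`. -/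
def twistNormSq (g : HermitianMetric (fun x : D => TangentSpace 𝓘(ℂ) x)) (h : HermitianMetric E)
    (x : D) (φ : CanonicalTwist E x) : ℝ :=
  let v := frame (fun x : D => TangentSpace 𝓘(ℂ) x) x
  let ν := frame E x
  ‖φ v ν ν‖ ^ 2 / (g.normSq x v * h.normSq x ν ^ 2)

lemma twistNormSq_eq (g : HermitianMetric (fun x : D => TangentSpace 𝓘(ℂ) x))
    (h : HermitianMetric E) (x : D) (φ : CanonicalTwist E x) (v : TangentSpace 𝓘(ℂ) x)
    (hv : v ≠ 0) (ν : E x) (hν : ν ≠ 0) :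
    twistNormSq g h x φ = ‖φ v ν ν‖ ^ 2 / (g.normSq x v * h.normSq x ν ^ 2) := by
  obtain ⟨c, hc⟩ := exists_eq_smul (E := fun x : D => TangentSpace 𝓘(ℂ) x) x
    (frame_ne_zero (E := fun x : D => TangentSpace 𝓘(ℂ) x) x) v
  have hc0 : c ≠ 0 := by rintro rfl; exact hv (by rw [hc, zero_smul])
  obtain ⟨d, hd⟩ := exists_eq_smul x (frame_ne_zero (E := E) x) ν
  have hd0 : d ≠ 0 := by rintro rfl; exact hν (by rw [hd, zero_smul])
  have hg : g.normSq x (frame (fun x : D => TangentSpace 𝓘(ℂ) x) x) ≠ 0 :=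
    (g.pos x _ (frame_ne_zero (E := fun x : D => TangentSpace 𝓘(ℂ) x) x)).ne'
  have hh : h.normSq x (frame E x) ≠ 0 := (h.pos x _ (frame_ne_zero (E := E) x)).ne'
  have hn : ‖c‖ ≠ 0 := by simpa using hc0
  have hm : ‖d‖ ≠ 0 := by simpa using hd0
  rw [hc, hd, g.normSq_smul, h.normSq_smul]
  simp only [twistNormSq, map_smul, LinearMap.smul_apply, smul_eq_mul, norm_mul]
  field_simp

variable (E) in
/-- A (not necessarily complex linear) map of real vector bundles `E → K̄_D ⊗ E`, fibrewise. -/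
abbrev RealBundleMap : Type _ := ∀ x : D, E x →ₗ[ℝ] Form01 E x

variable (E) in
/-- The bundle map `R` is smooth, as a map of total spaces. -/
def IsSmoothBundleMap (R : RealBundleMap E) : Prop :=
  ContMDiff (𝓘(ℝ, ℂ).prod 𝓘(ℝ, ℂ)) (𝓘(ℝ, ℂ).prod 𝓘(ℝ, ℂ →SL[starRingEnd ℂ] ℂ)) ∞
    (fun u : TotalSpace ℂ E =>
      TotalSpace.mk' (ℂ →SL[starRingEnd ℂ] ℂ) (E := fun x => Form01 E x) u.1 (R u.1 u.2))

/-- The pointwise adjoint `R^*` of `R` with respect to the real inner products `( , )`, written in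
the real orthogonal basis `ν, iν` of `E_x`; see `re_adjoint`. -/
def adjoint (g : HermitianMetric (fun x : D => TangentSpace 𝓘(ℂ) x)) (h : HermitianMetric E)
    (R : RealBundleMap E) (x : D) (A : Form01 E x) : E x :=
  let ν := frame E x
  ((((formRe g h x (R x ν) A : ℝ) : ℂ) +
    ((formRe g h x (R x (Complex.I • ν)) A : ℝ) : ℂ) * Complex.I) / h.normSq x ν) • ν

lemma re_adjoint (g : HermitianMetric (fun x : D => TangentSpace 𝓘(ℂ) x)) (h : HermitianMetric E)
    (R : RealBundleMap E) (x : D) (u : E x) (A : Form01 E x) :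
    h.re x u (adjoint g h R x A) = formRe g h x (R x u) A := by
  obtain ⟨c, rfl⟩ := exists_eq_smul x (frame_ne_zero (E := E) x) u
  have hh : h.normSq x (frame E x) ≠ 0 := (h.pos x _ (frame_ne_zero (E := E) x)).ne'
  have hadd : ∀ B C : Form01 E x, formRe g h x (B + C) A = formRe g h x B A + formRe g h x C A := by
    intro B C
    simp [formRe, formInner, add_div]
  have hsmul : ∀ (r : ℝ) (B : Form01 E x), formRe g h x (r • B) A = r * formRe g h x B A := by
    intro r B
    have : (r • B : Form01 E x) = (r : ℂ) • B := by
      ext v; rfl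
    rw [this]
    simp only [formRe, formInner, smul_apply, map_smul, LinearMap.smul_apply,
      smul_eq_mul]
    rw [mul_div_assoc, Complex.re_ofReal_mul]
  have hc : c • frame E x = c.re • frame E x + c.im • (Complex.I • frame E x) := by
    conv_lhs => rw [← Complex.re_add_im c]
    rw [add_smul, mul_smul]
    rfl
  conv_rhs => rw [hc, map_add, map_smul, map_smul, hadd, hsmul, hsmul]
  simp only [HermitianMetric.re, adjoint, map_smul, map_smulₛₗ, LinearMap.smul_apply, smul_eq_mul,
    h.inner_self]
  have hh' : (h.normSq x (frame E x) : ℂ) ≠ 0 := by exact_mod_cast hh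
  have : ∀ a b : ℝ, conj (((a : ℂ) + b * Complex.I) / (h.normSq x (frame E x) : ℂ)) *
      (c * (h.normSq x (frame E x) : ℂ)) = c * (a - b * Complex.I) := by
    intro a b
    simp only [map_div₀, map_add, map_mul, Complex.conj_ofReal, Complex.conj_I]
    field_simp
    ring
  rw [this]
  simp

/-- `L_t = ∂̄ + tR`. -/
def deformedDbar (t : ℝ) (R : RealBundleMap E) (ξ : ∀ x, E x) (x : D) : Form01 E x :=
  dbar ξ x + t • R x (ξ x)

/-- The kernel of `L_t : Ω⁰(E) → Ω^{0,1}(E)`. -/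
def kerDeformedDbar (t : ℝ) (R : RealBundleMap E) : Set (∀ x, E x) :=
  {ξ | IsSmoothSection ξ ∧ ∀ x, deformedDbar t R ξ x = 0}

end Forms

/-! ### The area measure and the formal adjoint `∂̄^*` -/

section Area

variable {D : Type*} [TopologicalSpace D] [ChartedSpace ℂ D] [IsManifold 𝓘(ℂ) ω D]
  [MeasurableSpace D]

/-- The area measure of `g` on the domain of the preferred chart `z` at `p`: `|∂_z|² dx dy`, where
`∂_z` is the coordinate vector field of the chart. -/
def chartArea (g : HermitianMetric (fun x : D => TangentSpace 𝓘(ℂ) x)) (p : D) : Measure D :=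
  ((volume.restrict (chartAt ℂ p).target).map (chartAt ℂ p).symm).withDensity
    (fun y => ENNReal.ofReal
      (g.normSq y (localFrame (fun x : D => TangentSpace 𝓘(ℂ) x) p y)))

/-- The area measure of `g`. The measures `chartArea g p` agree on overlaps of chart domains, and
their supremum is the measure on `D` that restricts to each of them. -/
def area (g : HermitianMetric (fun x : D => TangentSpace 𝓘(ℂ) x)) : Measure D :=
  ⨆ p : D, chartArea g p

variable {E : D → Type*} [∀ x, AddCommGroup (E x)] [∀ x, Module ℂ (E x)]
  [TopologicalSpace (TotalSpace ℂ E)] [∀ x, TopologicalSpace (E x)] [FiberBundle ℂ E]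
  [VectorBundle ℂ ℂ E] [∀ x, IsTopologicalAddGroup (E x)] [∀ x, ContinuousSMul ℂ (E x)]

/-- `∂̄^* α = σ`, for the formal `L²`-adjoint `∂̄^*` of `∂̄` on the closed surface `D`:
`∫ (∂̄ζ, α) = ∫ (ζ, σ)` for all smooth sections `ζ` of `E`. -/
def IsDbarStar (g : HermitianMetric (fun x : D => TangentSpace 𝓘(ℂ) x)) (h : HermitianMetric E)
    (α : ∀ x, Form01 E x) (σ : ∀ x, E x) : Prop :=
  ∀ ζ : ∀ x, E x, IsSmoothSection ζ →
    ∫ x, formRe g h x (dbar ζ x) (α x) ∂(area g) = ∫ x, h.re x (ζ x) (σ x) ∂(area g)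

end Area

end AntilinearDbar

end

/-!
If `ξ ∈ ker L_t`, then `∂̄ξ = -tRξ`. Applying `∂̄^* R = -R^* ∂̄` to `ξ` and pairing with `ξ` itself
gives `∫ (∂̄ξ, Rξ) = -∫ (∂̄ξ, Rξ)`, so this integral vanishes. By `R^* R = |φ|² Id` it equals
`-t ∫ |φ|² |ξ|²`. The area measure is locally finite and positive on open sets, because it restricts
to `|∂_z|² dx dy` on every chart, so the continuous function `|φ|² |ξ|²` vanishes identically. By
the identity theorem `φ ≠ 0` on a dense set, hence `ξ = 0` there, and everywhere by continuity.
-/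

namespace AntilinearDbar

open Set Topology Filter
open scoped ENNReal

section DenseComplement

variable {X : Type*} [TopologicalSpace X] [PreconnectedSpace X]

lemma dense_setOf_not_of_eventually_or {P : X → Prop}
    (hP : ∀ p, (∀ᶠ x in 𝓝 p, P x) ∨ ∀ᶠ x in 𝓝[≠] p, ¬P x) (hne : ∃ x, ¬P x) :
    Dense {x | ¬P x} := by
  have hclosed : IsClosed (interior {x | P x}) := by
    refine isClosed_of_closure_subset fun p hp =>
      (hP p).elim mem_interior_iff_mem_nhds.2 fun h => ?_
    obtain ⟨y, hyP, hy⟩ := ((mem_closure_iff_frequently.1 hp).and_eventually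
      (eventually_nhdsWithin_iff.1 h)).exists
    obtain rfl : y = p := by_contra fun hyp => hy hyp (interior_subset hyP)
    exact hyP
  rcases isClopen_iff.1 ⟨hclosed, isOpen_interior⟩ with hempty | huniv
  · exact interior_eq_empty_iff_dense_compl.1 hempty
  · obtain ⟨x, hx⟩ := hne
    exact absurd (interior_subset (huniv ▸ mem_univ x)) hx

end DenseComplement

section ChangeOfVariables

lemma det_restrictScalars_toSpanSingleton (c : ℂ) :
    ((ContinuousLinearMap.toSpanSingleton ℂ c).restrictScalars ℝ : ℂ →L[ℝ] ℂ).det = ‖c‖ ^ 2 := by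
  simp [ContinuousLinearMap.det, LinearMap.det_restrictScalars, Algebra.norm_complex_eq,
    Complex.normSq_eq_norm_sq]

lemma lintegral_image_eq_lintegral_sq_norm_deriv_mul {s : Set ℂ} {f f' : ℂ → ℂ}
    (hs : MeasurableSet s) (hf' : ∀ z ∈ s, HasDerivWithinAt f (f' z) s z) (hf : InjOn f s)
    (u : ℂ → ℝ≥0∞) :
    ∫⁻ w in f '' s, u w = ∫⁻ z in s, ENNReal.ofReal (‖f' z‖ ^ 2) * u (f z) := by
  rw [lintegral_image_eq_lintegral_abs_det_fderiv_mul volume hs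
    (fun z hz => (hf' z hz).hasFDerivWithinAt.restrictScalars ℝ) hf]
  simp only [det_restrictScalars_toSpanSingleton, abs_pow, abs_norm]

variable {X Y : Type*} [TopologicalSpace X] [TopologicalSpace Y] [MeasurableSpace X]
  [MeasurableSpace Y] [BorelSpace X] [BorelSpace Y] (e : OpenPartialHomeomorph X Y)

lemma measurableSet_image_of_subset_source {S : Set X} (hS : MeasurableSet S)
    (hSe : S ⊆ e.source) : MeasurableSet (e '' S) := by
  have hsymm : Measurable (e.target.domRestrict e.symm) :=
    (continuousOn_iff_continuous_domRestrict.1 e.continuousOn_symm).measurable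
  have himage : e '' S = (↑) '' (e.target.domRestrict e.symm ⁻¹' S) := by
    rw [e.image_eq_target_inter_inv_preimage hSe]
    ext z
    simp [domRestrict_apply, and_comm]
  rw [himage]
  exact e.open_target.measurableSet.subtype_image (hsymm hS)

variable (μ : Measure Y)

lemma aemeasurable_symm_restrict_target : AEMeasurable e.symm (μ.restrict e.target) :=
  e.continuousOn_symm.aemeasurable e.open_target.measurableSet

lemma map_symm_restrict_target_compl_source :
    (μ.restrict e.target).map e.symm e.sourceᶜ = 0 := by
  rw [Measure.map_apply_of_aemeasurable (aemeasurable_symm_restrict_target e μ)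
    e.open_source.measurableSet.compl, Measure.restrict_apply₀' e.open_target.nullMeasurableSet]
  exact measure_mono_null (fun z hz => hz.1 (e.map_target hz.2)) measure_empty

lemma restrict_map_symm_restrict_target {S : Set X} (hS : MeasurableSet S) (hSe : S ⊆ e.source) :
    ((μ.restrict e.target).map e.symm).restrict S = (μ.restrict (e '' S)).map e.symm := by
  have hsymm := aemeasurable_symm_restrict_target e μ
  rw [Measure.restrict_map_of_aemeasurable hsymm hS,
    Measure.restrict_restrict₀ (hsymm.nullMeasurableSet_preimage hS),
    e.image_eq_target_inter_inv_preimage hSe, inter_comm]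

lemma setLIntegral_map_symm_restrict_target {S : Set X} (hS : MeasurableSet S)
    (hSe : S ⊆ e.source) {u : X → ℝ≥0∞}
    (hu : AEMeasurable u (((μ.restrict e.target).map e.symm).restrict S)) :
    ∫⁻ x in S, u x ∂((μ.restrict e.target).map e.symm) = ∫⁻ y in e '' S, u (e.symm y) ∂μ := by
  rw [restrict_map_symm_restrict_target e μ hS hSe] at hu ⊢
  have hsub : e '' S ⊆ e.target := image_subset_iff.2 fun y hy => e.map_source (hSe hy)
  exact lintegral_map' hu <| (aemeasurable_symm_restrict_target e μ).mono_measure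
    (Measure.restrict_mono_set μ hsub)

end ChangeOfVariables

section HermitianMetric

variable {D : Type*} [TopologicalSpace D] [ChartedSpace ℂ D]
  {E : D → Type*} [∀ x, AddCommGroup (E x)] [∀ x, Module ℂ (E x)]
  [TopologicalSpace (TotalSpace ℂ E)] [∀ x, TopologicalSpace (E x)] [FiberBundle ℂ E]
  (h : HermitianMetric E)

lemma HermitianMetric.normSq_eq_zero_iff {x : D} {u : E x} : h.normSq x u = 0 ↔ u = 0 := by
  refine ⟨fun hu => by_contra fun hne => (h.pos x u hne).ne' hu, ?_⟩
  rintro rfl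
  simp [HermitianMetric.normSq]

lemma HermitianMetric.normSq_nonneg (x : D) (u : E x) : 0 ≤ h.normSq x u := by
  by_cases hu : u = 0
  · exact (h.normSq_eq_zero_iff.2 hu).ge
  · exact (h.pos x u hu).le

lemma HermitianMetric.continuousOn_normSq {ξ : ∀ x, E x} {s : Set D}
    (hξ : ContinuousOn (fun x => TotalSpace.mk' ℂ x (ξ x)) s) :
    ContinuousOn (fun x => h.normSq x (ξ x)) s :=
  h.smooth.continuous.comp_continuousOn hξ

lemma IsSmoothSection.continuous_normSq {ξ : ∀ x, E x} (hξ : IsSmoothSection ξ) :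
    Continuous fun x => h.normSq x (ξ x) :=
  h.smooth.continuous.comp (ContMDiff.continuous hξ)

end HermitianMetric

section LocalFrame

variable {D : Type*} [TopologicalSpace D]
  {E : D → Type*} [∀ x, AddCommGroup (E x)] [∀ x, Module ℂ (E x)]
  [TopologicalSpace (TotalSpace ℂ E)] [∀ x, TopologicalSpace (E x)] [FiberBundle ℂ E]
  [VectorBundle ℂ ℂ E]

lemma localFrame_ne_zero {p y : D} (hy : y ∈ (trivializationAt ℂ E p).baseSet) :
    localFrame E p y ≠ 0 := by
  intro hzero
  have hone := (trivializationAt ℂ E p).continuousLinearMapAt_symmL (R := ℂ) hy 1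
  rw [show (trivializationAt ℂ E p).symmL ℂ y 1 = 0 from hzero, map_zero] at hone
  exact zero_ne_one hone

variable (E)

lemma continuousOn_localFrame (p : D) :
    ContinuousOn (fun y => TotalSpace.mk' ℂ y (localFrame E p y))
      (trivializationAt ℂ E p).baseSet := by
  have hsymm := (trivializationAt ℂ E p).continuousOn_symm.comp
    (continuousOn_id.prodMk (continuousOn_const (c := (1 : ℂ)))) fun y hy => ⟨hy, mem_univ _⟩
  refine hsymm.congr fun y hy => ?_
  simp only [localFrame, Function.comp, Trivialization.symmL_apply _ hy]
  rfl

lemma eventuallyEq_trivializationAt_zero (p : D) :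
    (fun y => (trivializationAt ℂ E p (TotalSpace.mk' ℂ y (0 : E y))).2) =ᶠ[𝓝 p] fun _ => 0 := by
  filter_upwards [(trivializationAt ℂ E p).open_baseSet.mem_nhds
    (FiberBundle.mem_baseSet_trivializationAt' p)] with y hy
  exact congr_arg Prod.snd ((trivializationAt ℂ E p).zeroSection ℂ hy)

end LocalFrame

section ZeroSection

variable {D : Type*} [TopologicalSpace D] [ChartedSpace ℂ D]
  {E : D → Type*} [∀ x, AddCommGroup (E x)] [∀ x, Module ℂ (E x)]
  [TopologicalSpace (TotalSpace ℂ E)] [∀ x, TopologicalSpace (E x)] [FiberBundle ℂ E]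
  [VectorBundle ℂ ℂ E]

variable (E) in
lemma isSmoothSection_zero : IsSmoothSection (0 : ∀ x, E x) := fun p =>
  (contMDiffAt_section p).2 <|
    contMDiffAt_const.congr_of_eventuallyEq (eventuallyEq_trivializationAt_zero E p)

lemma antilinearPart_zero : antilinearPart 0 = 0 := by
  ext
  simp [antilinearPart]

variable (E) in
lemma dbar_zero (x : D) : dbar (0 : ∀ x, E x) x = 0 := by
  have hmfderiv : mfderiv 𝓘(ℝ, ℂ) 𝓘(ℝ, ℂ)
      (fun y => (trivializationAt ℂ E x (TotalSpace.mk' ℂ y ((0 : ∀ x, E x) y))).2) x = 0 :=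
    (eventuallyEq_trivializationAt_zero E x).mfderiv_eq.trans mfderiv_const
  rw [dbar, hmfderiv]
  exact (congrArg _ antilinearPart_zero).trans (ContinuousLinearMap.comp_zero _)

lemma zero_mem_kerDeformedDbar [∀ x, IsTopologicalAddGroup (E x)] [∀ x, ContinuousSMul ℂ (E x)]
    (t : ℝ) (R : RealBundleMap E) : 0 ∈ kerDeformedDbar t R :=
  ⟨isSmoothSection_zero E, fun x => by simp [deformedDbar, dbar_zero E x]⟩

end ZeroSection

section AdjointIdentities

variable {D : Type*} [TopologicalSpace D] [ChartedSpace ℂ D] [IsManifold 𝓘(ℂ) ω D]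
  {E : D → Type*} [∀ x, AddCommGroup (E x)] [∀ x, Module ℂ (E x)]
  [TopologicalSpace (TotalSpace ℂ E)] [∀ x, TopologicalSpace (E x)] [FiberBundle ℂ E]
  (g : HermitianMetric (fun x : D => TangentSpace 𝓘(ℂ) x)) (h : HermitianMetric E)

lemma formRe_comm (x : D) (A B : Form01 E x) : formRe g h x A B = formRe g h x B A := by
  simp only [formRe, formInner]
  rw [Complex.div_ofReal_re, Complex.div_ofReal_re, ← h.conj_symm, Complex.conj_re]

variable [∀ x, IsTopologicalAddGroup (E x)] [∀ x, ContinuousSMul ℂ (E x)]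

lemma formRe_smul_left (x : D) (r : ℝ) (A B : Form01 E x) :
    formRe g h x (r • A) B = r * formRe g h x A B := by
  rw [show r • A = (r : ℂ) • A from rfl]
  simp only [formRe, formInner, smul_apply, map_smul, LinearMap.smul_apply, smul_eq_mul]
  rw [mul_div_assoc, Complex.re_ofReal_mul]

variable [VectorBundle ℂ ℂ E] {R : RealBundleMap E}

lemma formRe_apply_self_of_adjoint_apply {x : D} {u : E x} {r : ℝ}
    (hr : adjoint g h R x (R x u) = r • u) :
    formRe g h x (R x u) (R x u) = r * h.normSq x u := by
  rw [← re_adjoint, hr, show r • u = (r : ℂ) • u from rfl, HermitianMetric.re, map_smulₛₗ,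
    h.inner_self]
  simp

lemma formRe_dbar_apply_of_mem_kerDeformedDbar {t : ℝ} {ξ : ∀ x, E x}
    (hξ : ξ ∈ kerDeformedDbar t R) {x : D} {r : ℝ}
    (hr : adjoint g h R x (R x (ξ x)) = r • ξ x) :
    formRe g h x (dbar ξ x) (R x (ξ x)) = -t * (r * h.normSq x (ξ x)) := by
  rw [eq_neg_of_add_eq_zero_left (hξ.2 x), ← neg_smul, formRe_smul_left,
    formRe_apply_self_of_adjoint_apply g h hr]

lemma integral_formRe_dbar_apply_eq_zero [MeasurableSpace D] {ξ : ∀ x, E x}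
    (hξ : IsSmoothSection ξ)
    (hR : IsDbarStar g h (fun x => R x (ξ x)) (fun x => -adjoint g h R x (dbar ξ x))) :
    ∫ x, formRe g h x (dbar ξ x) (R x (ξ x)) ∂area g = 0 := by
  have hneg : ∀ x, h.re x (ξ x) (-adjoint g h R x (dbar ξ x)) =
      -formRe g h x (dbar ξ x) (R x (ξ x)) := fun x => by
    rw [formRe_comm, ← re_adjoint]
    simp [HermitianMetric.re]
  have hself := hR ξ hξ
  simp only [hneg, integral_neg] at hself
  exact self_eq_neg.1 hself

end AdjointIdentities

section CoordinateVectorField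

variable {D : Type*} [TopologicalSpace D] [ChartedSpace ℂ D] [IsManifold 𝓘(ℂ) ω D]

/-- The coordinate vector field `∂_z` of the preferred chart `z` at `p`, at the point `y` of the
chart domain. -/
noncomputable abbrev coordVectorField (p y : D) : TangentSpace 𝓘(ℂ) y :=
  localFrame (fun x : D => TangentSpace 𝓘(ℂ) x) p y

lemma coordVectorField_ne_zero {p y : D} (hy : y ∈ (chartAt ℂ p).source) :
    coordVectorField p y ≠ 0 :=
  localFrame_ne_zero (E := fun x : D => TangentSpace 𝓘(ℂ) x) hy

lemma coordVectorField_eq_deriv_smul {p q y : D} (hp : y ∈ (chartAt ℂ p).source)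
    (hq : y ∈ (chartAt ℂ q).source) :
    coordVectorField p y =
      deriv (chartAt ℂ q ∘ (chartAt ℂ p).symm) (chartAt ℂ p y) • coordVectorField q y := by
  have hcomp := (tangentBundleCore 𝓘(ℂ) D).coordChange_comp (achart ℂ p) (achart ℂ q)
    (achart ℂ y) y ⟨⟨hp, hq⟩, mem_chart_source ℂ y⟩ 1
  have hderiv : (tangentBundleCore 𝓘(ℂ) D).coordChange (achart ℂ p) (achart ℂ q) y 1 =
      deriv (chartAt ℂ q ∘ (chartAt ℂ p).symm) (chartAt ℂ p y) • (1 : ℂ) := by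
    rw [tangentBundleCore_coordChange_achart]
    simp [fderivWithin_univ]
  rw [hderiv, map_smul] at hcomp
  simp only [coordVectorField, localFrame]
  rw [TangentBundle.symmL_trivializationAt_eq_core hp,
    TangentBundle.symmL_trivializationAt_eq_core hq]
  exact hcomp.symm

lemma differentiableAt_chartAt_comp_symm {p q y : D} (hp : y ∈ (chartAt ℂ p).source)
    (hq : y ∈ (chartAt ℂ q).source) :
    DifferentiableAt ℂ (chartAt ℂ q ∘ (chartAt ℂ p).symm) (chartAt ℂ p y) := by
  have hsymm : MDifferentiableAt 𝓘(ℂ) 𝓘(ℂ) (chartAt ℂ p).symm (chartAt ℂ p y) :=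
    mdifferentiableAt_atlas_symm (chart_mem_atlas ℂ p) ((chartAt ℂ p).map_source hp)
  have hchart : MDifferentiableAt 𝓘(ℂ) 𝓘(ℂ) (chartAt ℂ q)
      ((chartAt ℂ p).symm (chartAt ℂ p y)) := by
    rw [(chartAt ℂ p).left_inv hp]
    exact mdifferentiableAt_atlas (chart_mem_atlas ℂ q) hq
  exact (hchart.comp _ hsymm).differentiableAt

variable (g : HermitianMetric (fun x : D => TangentSpace 𝓘(ℂ) x))

/-- The density `|∂_z|²` of the area measure with respect to `dx dy`, in the preferred coordinate
`z = x + iy` at `p`. -/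
noncomputable def areaDensity (p y : D) : ℝ := g.normSq y (coordVectorField p y)

lemma areaDensity_pos {p y : D} (hy : y ∈ (chartAt ℂ p).source) : 0 < areaDensity g p y :=
  g.pos y _ (coordVectorField_ne_zero hy)

lemma continuousOn_areaDensity (p : D) : ContinuousOn (areaDensity g p) (chartAt ℂ p).source :=
  g.continuousOn_normSq (continuousOn_localFrame (fun x : D => TangentSpace 𝓘(ℂ) x) p)

lemma areaDensity_eq_sq_norm_deriv_mul {p q y : D} (hp : y ∈ (chartAt ℂ p).source)
    (hq : y ∈ (chartAt ℂ q).source) :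
    areaDensity g p y =
      ‖deriv (chartAt ℂ q ∘ (chartAt ℂ p).symm) (chartAt ℂ p y)‖ ^ 2 * areaDensity g q y := by
  rw [areaDensity, coordVectorField_eq_deriv_smul hp hq, g.normSq_smul, areaDensity]

end CoordinateVectorField

section Area

variable {D : Type*} [TopologicalSpace D] [ChartedSpace ℂ D] [IsManifold 𝓘(ℂ) ω D]
  [MeasurableSpace D] [BorelSpace D] (g : HermitianMetric (fun x : D => TangentSpace 𝓘(ℂ) x))

lemma chartArea_compl_source (p : D) : chartArea g p (chartAt ℂ p).sourceᶜ = 0 :=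
  withDensity_absolutelyContinuous _ _ (map_symm_restrict_target_compl_source (chartAt ℂ p) volume)

lemma chartArea_apply {p : D} {S : Set D} (hS : MeasurableSet S) (hp : S ⊆ (chartAt ℂ p).source) :
    chartArea g p S =
      ∫⁻ z in chartAt ℂ p '' S, ENNReal.ofReal (areaDensity g p ((chartAt ℂ p).symm z)) := by
  rw [chartArea, withDensity_apply _ hS]
  exact setLIntegral_map_symm_restrict_target (chartAt ℂ p) volume hS hp
    ((continuousOn_areaDensity g p).mono hp |>.aemeasurable hS).ennreal_ofReal

lemma chartArea_apply_eq {p q : D} {S : Set D} (hS : MeasurableSet S)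
    (hp : S ⊆ (chartAt ℂ p).source) (hq : S ⊆ (chartAt ℂ q).source) :
    chartArea g p S = chartArea g q S := by
  have himage : chartAt ℂ q '' S = (chartAt ℂ q ∘ (chartAt ℂ p).symm) '' (chartAt ℂ p '' S) := by
    rw [image_image]
    exact image_congr fun y hy => by simp [(chartAt ℂ p).left_inv (hp hy)]
  have hSp := measurableSet_image_of_subset_source (chartAt ℂ p) hS hp
  rw [chartArea_apply g hS hp, chartArea_apply g hS hq, himage,
    lintegral_image_eq_lintegral_sq_norm_deriv_mul hSp
      (f' := deriv (chartAt ℂ q ∘ (chartAt ℂ p).symm))]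
  · refine setLIntegral_congr_fun hSp ?_
    rintro _ ⟨y, hy, rfl⟩
    simp only [Function.comp_apply, (chartAt ℂ p).left_inv (hp hy),
      (chartAt ℂ q).left_inv (hq hy)]
    rw [areaDensity_eq_sq_norm_deriv_mul g (hp hy) (hq hy), ENNReal.ofReal_mul (sq_nonneg _)]
  · rintro _ ⟨y, hy, rfl⟩
    exact (differentiableAt_chartAt_comp_symm (hp hy) (hq hy)).hasDerivAt.hasDerivWithinAt
  · rintro _ ⟨y, hy, rfl⟩ _ ⟨z, hz, rfl⟩ hyz
    simp only [Function.comp_apply, (chartAt ℂ p).left_inv (hp hy),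
      (chartAt ℂ p).left_inv (hp hz)] at hyz
    rw [(chartAt ℂ q).injOn (hq hy) (hq hz) hyz]

-- A bound independent of `q` that is sharp on the chart domain at `p` but lets the other charts be
-- arbitrary elsewhere, so that it passes to the supremum `area g`.
lemma chartArea_le_chartArea_add_top_restrict (p q : D) :
    chartArea g q ≤ chartArea g p + (⊤ : Measure D).restrict (chartAt ℂ p).sourceᶜ := by
  refine Measure.le_iff.2 fun S hS => ?_
  have hp := (chartAt ℂ p).open_source.measurableSet
  have hq := (chartAt ℂ q).open_source.measurableSet
  have hmem : chartArea g q (S ∩ (chartAt ℂ p).source) ≤ chartArea g p S := calc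
    chartArea g q (S ∩ (chartAt ℂ p).source)
      = chartArea g q (S ∩ (chartAt ℂ p).source ∩ (chartAt ℂ q).source) :=
        (measure_inter_conull (chartArea_compl_source g q)).symm
    _ = chartArea g p (S ∩ (chartAt ℂ p).source ∩ (chartAt ℂ q).source) :=
        chartArea_apply_eq g ((hS.inter hp).inter hq) inter_subset_right
          (inter_subset_left.trans inter_subset_right)
    _ ≤ chartArea g p S := measure_mono (inter_subset_left.trans inter_subset_left)
  calc chartArea g q S
      = chartArea g q (S ∩ (chartAt ℂ p).source) + chartArea g q (S \ (chartAt ℂ p).source) :=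
        (measure_inter_add_sdiff S hp).symm
    _ ≤ chartArea g p S + (⊤ : Measure D) (S ∩ (chartAt ℂ p).sourceᶜ) :=
        add_le_add hmem ((le_top : chartArea g q ≤ ⊤) _)
    _ = (chartArea g p + (⊤ : Measure D).restrict (chartAt ℂ p).sourceᶜ) S := by
        rw [Measure.add_apply, Measure.restrict_apply hS]

lemma area_apply_eq_chartArea {p : D} {S : Set D} (hS : MeasurableSet S)
    (hp : S ⊆ (chartAt ℂ p).source) : area g S = chartArea g p S := by
  refine le_antisymm ?_ (le_iSup (chartArea g) p S)
  calc area g S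
      ≤ (chartArea g p + (⊤ : Measure D).restrict (chartAt ℂ p).sourceᶜ) S :=
        iSup_le (chartArea_le_chartArea_add_top_restrict g p) S
    _ = chartArea g p S := by
        rw [Measure.add_apply, Measure.restrict_apply hS,
          (disjoint_compl_right.mono_left hp).inter_eq, measure_empty, add_zero]

instance isLocallyFiniteMeasure_area : IsLocallyFiniteMeasure (area g) := by
  refine ⟨fun p => ?_⟩
  have hsource : (chartAt ℂ p).source ∈ 𝓝 p := chart_source_mem_nhds ℂ p
  obtain ⟨C, hC⟩ := exists_gt (areaDensity g p p)
  have hbounded : ∀ᶠ y in 𝓝 p, y ∈ (chartAt ℂ p).source ∧ areaDensity g p y < C ∧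
      chartAt ℂ p y ∈ Metric.ball (chartAt ℂ p p) 1 :=
    Filter.Eventually.and hsource <|
      ((continuousOn_areaDensity g p).continuousAt hsource |>.eventually_lt_const hC).and <|
        ((chartAt ℂ p).continuousAt (mem_chart_source ℂ p)).eventually
          (Metric.ball_mem_nhds _ one_pos)
  obtain ⟨V, hV, hVopen, hpV⟩ := eventually_nhds_iff.1 hbounded
  have hVp : V ⊆ (chartAt ℂ p).source := fun y hy => (hV y hy).1
  refine ⟨V, hVopen.mem_nhds hpV, ?_⟩
  calc area g V
      = ∫⁻ z in chartAt ℂ p '' V, ENNReal.ofReal (areaDensity g p ((chartAt ℂ p).symm z)) := by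
        rw [area_apply_eq_chartArea g hVopen.measurableSet hVp,
          chartArea_apply g hVopen.measurableSet hVp]
    _ ≤ ∫⁻ _ in chartAt ℂ p '' V, ENNReal.ofReal C := by
        refine setLIntegral_mono measurable_const ?_
        rintro _ ⟨y, hy, rfl⟩
        rw [(chartAt ℂ p).left_inv (hVp hy)]
        exact ENNReal.ofReal_le_ofReal (hV y hy).2.1.le
    _ ≤ ENNReal.ofReal C * volume (Metric.ball (chartAt ℂ p p) 1) := by
        rw [setLIntegral_const]
        gcongr
        exact image_subset_iff.2 fun y hy => (hV y hy).2.2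
    _ < ⊤ := ENNReal.mul_lt_top ENNReal.ofReal_lt_top measure_ball_lt_top

lemma volume_image_eq_zero_of_chartArea_eq_zero {p : D} {S : Set D} (hS : MeasurableSet S)
    (hp : S ⊆ (chartAt ℂ p).source) (hzero : chartArea g p S = 0) :
    volume (chartAt ℂ p '' S) = 0 := by
  have hSp := measurableSet_image_of_subset_source (chartAt ℂ p) hS hp
  have hpos : ∀ z ∈ chartAt ℂ p '' S,
      ENNReal.ofReal (areaDensity g p ((chartAt ℂ p).symm z)) ≠ 0 := by
    rintro _ ⟨y, hy, rfl⟩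
    rw [(chartAt ℂ p).left_inv (hp hy)]
    exact (ENNReal.ofReal_pos.2 (areaDensity_pos g (hp hy))).ne'
  have hmeas : AEMeasurable (fun z => ENNReal.ofReal (areaDensity g p ((chartAt ℂ p).symm z)))
      (volume.restrict (chartAt ℂ p '' S)) := by
    refine (((continuousOn_areaDensity g p).comp (chartAt ℂ p).continuousOn_symm
      (chartAt ℂ p).mapsTo_symm).mono ?_ |>.aemeasurable hSp).ennreal_ofReal
    exact image_subset_iff.2 fun y hy => (chartAt ℂ p).map_source (hp hy)
  rw [chartArea_apply g hS hp, setLIntegral_eq_zero_iff' hSp hmeas] at hzero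
  exact measure_eq_zero_iff_ae_notMem.2 (hzero.mono fun z hz hzS => hpos z hzS (hz hzS))

instance isOpenPosMeasure_area : (area g).IsOpenPosMeasure := by
  refine ⟨fun U hU ⟨p, hpU⟩ hzero => ?_⟩
  have hopen : IsOpen (U ∩ (chartAt ℂ p).source) := hU.inter (chartAt ℂ p).open_source
  have hchart : chartArea g p (U ∩ (chartAt ℂ p).source) = 0 := by
    rw [← area_apply_eq_chartArea g hopen.measurableSet inter_subset_right]
    exact measure_mono_null inter_subset_left hzero
  refine ((chartAt ℂ p).isOpen_image_of_subset_source hopen inter_subset_right).measure_ne_zero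
    volume (Nonempty.image _ ⟨p, hpU, mem_chart_source ℂ p⟩) ?_
  exact volume_image_eq_zero_of_chartArea_eq_zero g hopen.measurableSet inter_subset_right hchart

end Area

section FrameDomain

variable {D : Type*} [TopologicalSpace D] [ChartedSpace ℂ D]
  (E : D → Type*) [TopologicalSpace (TotalSpace ℂ E)] [∀ x, TopologicalSpace (E x)]
  [FiberBundle ℂ E]

/-- The common domain of the preferred coordinate and the preferred local frame at `p`. -/
def frameDomain (p : D) : Set D := (chartAt ℂ p).source ∩ (trivializationAt ℂ E p).baseSet

lemma frameDomain_mem_nhds (p : D) : frameDomain E p ∈ 𝓝 p :=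
  inter_mem (chart_source_mem_nhds ℂ p) <| (trivializationAt ℂ E p).open_baseSet.mem_nhds
    (FiberBundle.mem_baseSet_trivializationAt' p)

end FrameDomain

section Twist

variable {D : Type*} [TopologicalSpace D] [ChartedSpace ℂ D] [IsManifold 𝓘(ℂ) ω D]
  {E : D → Type*} [∀ x, AddCommGroup (E x)] [∀ x, Module ℂ (E x)]
  [TopologicalSpace (TotalSpace ℂ E)] [∀ x, TopologicalSpace (E x)] [FiberBundle ℂ E]
  [VectorBundle ℂ ℂ E]

/-- The coefficient `φ(∂_z, ν, ν)` at `y` of a section of `K_D ⊗ (E^*)²`, in the preferred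
coordinate `z` and the preferred local frame `ν` at `p`. -/
noncomputable def twistCoeff (φ : ∀ x : D, CanonicalTwist E x) (p y : D) : ℂ :=
  φ y (coordVectorField p y) (localFrame E p y) (localFrame E p y)

lemma twistCoeff_eq_zero_iff (φ : ∀ x : D, CanonicalTwist E x) {p y : D}
    (hy : y ∈ frameDomain E p) : twistCoeff φ p y = 0 ↔ φ y = 0 := by
  refine ⟨fun hzero => ?_, fun hzero => by simp [twistCoeff, hzero]⟩
  refine LinearMap.ext fun v => LinearMap.ext fun u => LinearMap.ext fun w => ?_
  obtain ⟨a, rfl⟩ := exists_eq_smul (E := fun x : D => TangentSpace 𝓘(ℂ) x) y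
    (coordVectorField_ne_zero hy.1) v
  obtain ⟨b, rfl⟩ := exists_eq_smul y (localFrame_ne_zero hy.2) u
  obtain ⟨c, rfl⟩ := exists_eq_smul y (localFrame_ne_zero hy.2) w
  rw [twistCoeff] at hzero
  simp only [map_smul, LinearMap.smul_apply, hzero, smul_zero, LinearMap.zero_apply]

lemma IsHolomorphicTwist.analyticAt_twistCoeff {φ : ∀ x : D, CanonicalTwist E x}
    (hφ : IsHolomorphicTwist E φ) (p : D) :
    AnalyticAt ℂ (twistCoeff φ p ∘ (chartAt ℂ p).symm) (chartAt ℂ p p) := by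
  set e := chartAt ℂ p
  have hopen : IsOpen (e.target ∩ e.symm ⁻¹' frameDomain E p) :=
    e.isOpen_inter_preimage_symm (e.open_source.inter (trivializationAt ℂ E p).open_baseSet)
  have hmem : e p ∈ e.target ∩ e.symm ⁻¹' frameDomain E p := by
    refine ⟨mem_chart_target ℂ p, ?_⟩
    rw [mem_preimage, e.left_inv (mem_chart_source ℂ p)]
    exact mem_of_mem_nhds (frameDomain_mem_nhds E p)
  have hdiff : DifferentiableOn ℂ (twistCoeff φ p ∘ e.symm)
      (e.target ∩ e.symm ⁻¹' frameDomain E p) :=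
    mdifferentiableOn_iff_differentiableOn.1 <| (hφ p).comp
      ((mdifferentiableOn_atlas_symm (chart_mem_atlas ℂ p)).mono inter_subset_left)
      inter_subset_right
  exact hdiff.analyticAt (hopen.mem_nhds hmem)

lemma IsHolomorphicTwist.eventually_eq_zero_or_eventually_ne_zero
    {φ : ∀ x : D, CanonicalTwist E x} (hφ : IsHolomorphicTwist E φ) (p : D) :
    (∀ᶠ x in 𝓝 p, φ x = 0) ∨ ∀ᶠ x in 𝓝[≠] p, φ x ≠ 0 := by
  have hcoeff : ∀ᶠ x in 𝓝 p,
      ((twistCoeff φ p ∘ (chartAt ℂ p).symm) (chartAt ℂ p x) = 0 ↔ φ x = 0) := by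
    filter_upwards [frameDomain_mem_nhds E p] with x hx
    rw [Function.comp_apply, (chartAt ℂ p).left_inv hx.1, twistCoeff_eq_zero_iff φ hx]
  have hcont := (chartAt ℂ p).continuousAt (mem_chart_source ℂ p)
  refine (hφ.analyticAt_twistCoeff p).eventually_eq_zero_or_eventually_ne_zero.imp
    (fun hzero => ?_) (fun hne => ?_)
  · filter_upwards [hcont.eventually hzero, hcoeff] with x hx hiff
    exact hiff.1 hx
  · refine eventually_nhdsWithin_iff.2 ?_
    filter_upwards [hcont.eventually (eventually_nhdsWithin_iff.1 hne), hcoeff,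
      chart_source_mem_nhds ℂ p] with x hx hiff hxs hxp
    exact mt hiff.2 (hx fun heq => hxp ((chartAt ℂ p).injOn hxs (mem_chart_source ℂ p) heq))

lemma IsHolomorphicTwist.dense_ne_zero [PreconnectedSpace D] {φ : ∀ x : D, CanonicalTwist E x}
    (hφ : IsHolomorphicTwist E φ) (hφ0 : ∃ x, φ x ≠ 0) : Dense {x | φ x ≠ 0} :=
  dense_setOf_not_of_eventually_or hφ.eventually_eq_zero_or_eventually_ne_zero hφ0

variable (g : HermitianMetric (fun x : D => TangentSpace 𝓘(ℂ) x)) (h : HermitianMetric E)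

lemma twistNormSq_nonneg (x : D) (φ : CanonicalTwist E x) : 0 ≤ twistNormSq g h x φ :=
  div_nonneg (sq_nonneg _) (mul_nonneg (g.normSq_nonneg x _) (sq_nonneg _))

lemma twistNormSq_eq_zero_iff (φ : ∀ x : D, CanonicalTwist E x) (x : D) :
    twistNormSq g h x (φ x) = 0 ↔ φ x = 0 := by
  have hg : g.normSq x (frame (fun x : D => TangentSpace 𝓘(ℂ) x) x) ≠ 0 :=
    (g.pos x _ (frame_ne_zero (E := fun x : D => TangentSpace 𝓘(ℂ) x) x)).ne'
  have hh : h.normSq x (frame E x) ≠ 0 := (h.pos x _ (frame_ne_zero x)).ne'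
  rw [← twistCoeff_eq_zero_iff φ (mem_of_mem_nhds (frameDomain_mem_nhds E x)), twistNormSq,
    div_eq_zero_iff, or_iff_left (mul_ne_zero hg (pow_ne_zero 2 hh)), sq_eq_zero_iff, norm_eq_zero]
  rfl

variable [∀ x, IsTopologicalAddGroup (E x)] [∀ x, ContinuousSMul ℂ (E x)]

lemma IsHolomorphicTwist.continuous_twistNormSq {φ : ∀ x : D, CanonicalTwist E x}
    (hφ : IsHolomorphicTwist E φ) : Continuous fun x => twistNormSq g h x (φ x) := by
  refine continuous_iff_continuousAt.2 fun p => ?_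
  have hlocal : ContinuousOn
      (fun y => ‖twistCoeff φ p y‖ ^ 2 / (areaDensity g p y * h.normSq y (localFrame E p y) ^ 2))
      (frameDomain E p) := by
    refine ((hφ p).continuousOn.norm.pow 2).div
      (((continuousOn_areaDensity g p).mono inter_subset_left).mul
        (((h.continuousOn_normSq (continuousOn_localFrame E p)).mono inter_subset_right).pow 2))
      fun y hy => ?_
    exact mul_ne_zero (areaDensity_pos g hy.1).ne'
      (pow_ne_zero 2 (h.pos y _ (localFrame_ne_zero hy.2)).ne')
  refine (hlocal.continuousAt (frameDomain_mem_nhds E p)).congr ?_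
  filter_upwards [frameDomain_mem_nhds E p] with y hy
  exact (twistNormSq_eq g h y (φ y) _ (coordVectorField_ne_zero hy.1) _
    (localFrame_ne_zero hy.2)).symm

end Twist

section KernelVanishing

variable {D : Type*} [TopologicalSpace D] [CompactSpace D] [PreconnectedSpace D]
  [ChartedSpace ℂ D] [IsManifold 𝓘(ℂ) ω D] [MeasurableSpace D] [BorelSpace D]
  {E : D → Type*} [∀ x, AddCommGroup (E x)] [∀ x, Module ℂ (E x)]
  [TopologicalSpace (TotalSpace ℂ E)] [∀ x, TopologicalSpace (E x)] [FiberBundle ℂ E]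
  [VectorBundle ℂ ℂ E] [∀ x, IsTopologicalAddGroup (E x)] [∀ x, ContinuousSMul ℂ (E x)]

lemma IsHolomorphicTwist.eq_zero_of_integral_eq_zero
    (g : HermitianMetric (fun x : D => TangentSpace 𝓘(ℂ) x)) (h : HermitianMetric E)
    {φ : ∀ x : D, CanonicalTwist E x} (hφ : IsHolomorphicTwist E φ) (hφ0 : ∃ x, φ x ≠ 0)
    {ξ : ∀ x, E x} (hξ : IsSmoothSection ξ)
    (hint : ∫ x, twistNormSq g h x (φ x) * h.normSq x (ξ x) ∂area g = 0) : ξ = 0 := by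
  have hcont := hξ.continuous_normSq h
  by_contra hne
  obtain ⟨p, hp⟩ := Function.ne_iff.1 hne
  obtain ⟨x, hφx, hξx⟩ := (hφ.dense_ne_zero hφ0).exists_mem_open
    (isOpen_ne_fun hcont continuous_const) ⟨p, mt h.normSq_eq_zero_iff.1 hp⟩
  refine hint.not_gt <| ((hφ.continuous_twistNormSq g h).mul
    hcont).integral_pos_of_hasCompactSupport_nonneg_nonzero (.of_compactSpace _)
    (fun y => mul_nonneg (twistNormSq_nonneg g h y _) (h.normSq_nonneg y _)) (x := x) ?_
  exact mul_ne_zero (mt (twistNormSq_eq_zero_iff g h φ x).1 hφx) hξx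

end KernelVanishing

end AntilinearDbar

open AntilinearDbar in
theorem mainTheorem11_general
    {D : Type*} [TopologicalSpace D] [CompactSpace D] [PreconnectedSpace D]
    [ChartedSpace ℂ D] [IsManifold 𝓘(ℂ) ω D] [MeasurableSpace D] [BorelSpace D]
    {N : D → Type*} [∀ x, AddCommGroup (N x)] [∀ x, Module ℂ (N x)]
    [TopologicalSpace (TotalSpace ℂ N)] [∀ x, TopologicalSpace (N x)]
    [∀ x, IsTopologicalAddGroup (N x)] [∀ x, ContinuousSMul ℂ (N x)]
    [FiberBundle ℂ N] [VectorBundle ℂ ℂ N]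
    (g : HermitianMetric (fun x : D => TangentSpace 𝓘(ℂ) x)) (h : HermitianMetric N)
    (φ : ∀ x : D, CanonicalTwist N x) (hφ : IsHolomorphicTwist N φ) (hφ0 : ∃ x, φ x ≠ 0)
    (R : RealBundleMap N)
    (hRR : ∀ (x : D) (u : N x),
      AntilinearDbar.adjoint g h R x (R x u) = twistNormSq g h x (φ x) • u)
    (hRd : ∀ ξ : ∀ x, N x, IsSmoothSection ξ →
      ∫ x, formRe g h x (dbar ξ x) (R x (ξ x)) ∂area g = 0)
    (t : ℝ) (ht : t ≠ 0) :
    kerDeformedDbar t R = {0} := by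
  refine Set.eq_singleton_iff_unique_mem.2 ⟨zero_mem_kerDeformedDbar t R, fun ξ hξ => ?_⟩
  refine hφ.eq_zero_of_integral_eq_zero g h hφ0 hξ.1 ?_
  have hcross := hRd ξ hξ.1
  simp only [formRe_dbar_apply_of_mem_kerDeformedDbar g h hξ (hRR _ _), integral_const_mul]
    at hcross
  exact (mul_eq_zero.1 hcross).resolve_left (neg_ne_zero.2 ht)

open AntilinearDbar in
theorem mainTheorem11
    {D : Type*} [TopologicalSpace D] [T2Space D] [CompactSpace D] [ConnectedSpace D]
    [ChartedSpace ℂ D] [IsManifold 𝓘(ℂ) ω D] [MeasurableSpace D] [BorelSpace D]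
    {N : D → Type*} [∀ x, AddCommGroup (N x)] [∀ x, Module ℂ (N x)]
    [TopologicalSpace (TotalSpace ℂ N)] [∀ x, TopologicalSpace (N x)]
    [∀ x, IsTopologicalAddGroup (N x)] [∀ x, ContinuousSMul ℂ (N x)]
    [FiberBundle ℂ N] [VectorBundle ℂ ℂ N] [ContMDiffVectorBundle ω ℂ N 𝓘(ℂ)]
    (g : HermitianMetric (fun x : D => TangentSpace 𝓘(ℂ) x)) (h : HermitianMetric N)
    (φ : ∀ x : D, CanonicalTwist N x) (hφ : IsHolomorphicTwist N φ) (hφ0 : ∃ x, φ x ≠ 0)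
    (R : RealBundleMap N) (hR : IsSmoothBundleMap N R)
    (hRJ : ∀ (x : D) (u : N x), R x (Complex.I • u) = -(Complex.I • R x u))
    (hRR : ∀ (x : D) (u : N x),
      AntilinearDbar.adjoint g h R x (R x u) = twistNormSq g h x (φ x) • u)
    (hRd : ∀ ξ : ∀ x, N x, IsSmoothSection ξ →
      IsDbarStar g h (fun x => R x (ξ x))
        (fun x => -AntilinearDbar.adjoint g h R x (dbar ξ x)))
    (t : ℝ) (ht : t ≠ 0) :
    kerDeformedDbar t R = {0} :=
  mainTheorem11_general g h φ hφ hφ0 R hRR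
    (fun ξ hξ => integral_formRe_dbar_apply_eq_zero g h hξ (hRd ξ hξ)) t ht
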